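/- Let $n$ be a natural number, let $M_n(\mathbb{C})$ be the algebra of complex $n\times n$ matrices with its usual (norm) topology, let $D_n\subset M_n(\mathbb{C})$ be the subalgebra of diagonal matrices, and let $E\colon M_n(\mathbb{C})\to D_n$ be the map which erases the off-diagonal entries. For an idempotent $q\in M_n(\mathbb{C})$, let $[q]$ denote its range projection, that is, the orthogonal projection of $\mathbb{C}^n$ (with its standard inner product) onto the range of $q$, and let $\{[q]\}'=\{x\in M_n(\mathbb{C}) : x[q]=[q]x\}$ be its commutant. Theorem. For every $d\in D_n$, the set $$\{\,q\in M_n(\mathbb{C}) : q^2=q,\ E(q)=d,\ \{[q]\}'\cap D_n=\mathbb{C}\,\mathrm{id}\,\}$$ is path-connected (in the subspace topology) whenever it is nonempty. -/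

import Mathlib

noncomputable section

namespace FixedDiagonal

/-- The algebra `D_n` of diagonal matrices, as a subalgebra of `M_n(ℂ)`. -/
def diagAlg (n : ℕ) : Subalgebra ℂ (Matrix (Fin n) (Fin n) ℂ) :=
  (Matrix.diagonalAlgHom (n := Fin n) (α := ℂ) ℂ).range

/-- The diagonal conditional expectation `E : M_n(ℂ) → D_n`, which erases the off-diagonal
entries. -/
def condExpDiag {n : ℕ} (x : Matrix (Fin n) (Fin n) ℂ) : Matrix (Fin n) (Fin n) ℂ :=
  Matrix.diagonal x.diag

/-- The range projection `[x]`: the matrix of the orthogonal projection of `ℂⁿ`, with its standard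
inner product, onto the range of `x`. -/
def rangeProj {n : ℕ} (x : Matrix (Fin n) (Fin n) ℂ) : Matrix (Fin n) (Fin n) ℂ :=
  (Matrix.toEuclideanCLM (n := Fin n) (𝕜 := ℂ)).symm
    (LinearMap.range (Matrix.toEuclideanLin x)).starProjection

/-- The relative commutant `{x}' ∩ D_n`. -/
def relCommutant {n : ℕ} (x : Matrix (Fin n) (Fin n) ℂ) :
    Subalgebra ℂ (Matrix (Fin n) (Fin n) ℂ) :=
  Subalgebra.centralizer ℂ {x} ⊓ diagAlg n

/-- The idempotents `q` with `E(q) = d` and `{[q]}' ∩ D_n = ℂ id`; here `⊥` is the subalgebra of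
scalar multiples of the identity. -/
def irreducibleIdempotents {n : ℕ} (d : Matrix (Fin n) (Fin n) ℂ) :
    Set (Matrix (Fin n) (Fin n) ℂ) :=
  {q | IsIdempotentElem q ∧ condExpDiag q = d ∧ relCommutant (rangeProj q) = ⊥}

end FixedDiagonal

end

/-! Factor an idempotent as `q = A * B` with `B * A = 1`; the inner size `r` is the trace of `d`.
The commutant condition depends only on the column space of `A`. Once `A` is fixed, the conditions
on `B` are linear: `B * A = 1` and `diag (A * B) = t`. These equations are tied by `tr (B * A) = tr
(A * B)`; a slack scalar `c` absorbs this, giving `factorMap A`. By duality `factorMap A` is onto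
exactly when `A` is irreducible (`surjective_factorMap` and its converse). Given two idempotents,
move `A` to `A'` along a complex line. Surjectivity fails at only finitely many parameters near
which a solution cannot be continued, a finite set does not disconnect `ℂ`, and the solutions over
one parameter form an affine space (`joinedIn_pencilSolutions`). -/

open Matrix

namespace FixedDiagonal

/-! ### Linear equations depending on a complex parameter -/

section Pencil

variable {E F : Type*} [AddCommGroup E] [Module ℂ E] [AddCommGroup F] [Module ℂ F]

/-- The pairs `(z, e)` where `T₀ + z • D` is onto and `e` solves `(T₀ + z • D) e = y`. -/
def pencilSolutions (T₀ D : E →ₗ[ℂ] F) (y : F) : Set (ℂ × E) :=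
  {p | Function.Surjective (T₀ + p.1 • D) ∧ (T₀ + p.1 • D) p.2 = y}

theorem isPathConnected_compl_of_finite {s : Set ℂ} (hs : s.Finite) : IsPathConnected sᶜ := by
  refine hs.countable.isPathConnected_compl_of_one_lt_rank ?_
  rw [Complex.rank_real_complex]
  exact Cardinal.one_lt_two

theorem finite_det_add_smul_eq_zero {ι : Type*} [Fintype ι] [DecidableEq ι]
    (M N : Matrix ι ι ℂ) {z₀ : ℂ} (h : (M + z₀ • N).det ≠ 0) :
    {z : ℂ | (M + z • N).det = 0}.Finite := by
  let p : Polynomial ℂ :=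
    (M.map Polynomial.C + (Polynomial.X : Polynomial ℂ) • N.map Polynomial.C).det
  have hp : ∀ z, p.eval z = (M + z • N).det := by
    intro z
    have := RingHom.map_det (Polynomial.evalRingHom z)
      (M.map Polynomial.C + (Polynomial.X : Polynomial ℂ) • N.map Polynomial.C)
    rw [Polynomial.coe_evalRingHom] at this
    rw [this]
    congr 1
    ext i j
    simp
    ring
  have hp0 : p ≠ 0 := by
    intro h0
    apply h
    rw [← hp, h0, Polynomial.eval_zero]
  refine (p.rootSet_finite ℂ).subset fun z hz => ?_
  rw [Polynomial.mem_rootSet]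
  refine ⟨hp0, ?_⟩
  rw [Polynomial.coe_aeval_eq_eval, hp]
  exact hz

variable [TopologicalSpace E] [IsTopologicalAddGroup E] [ContinuousSMul ℂ E]

theorem continuousOn_matrix_inv {ι : Type*} [Fintype ι] [DecidableEq ι] :
    ContinuousOn (fun M : Matrix ι ι ℂ => M⁻¹) {M | M.det ≠ 0} := by
  simp only [Matrix.inv_def, Ring.inverse_eq_inv']
  refine ContinuousOn.smul (ContinuousOn.inv₀ ?_ fun _ h => h) ?_
  · exact (Continuous.matrix_det continuous_id).continuousOn
  · exact (Continuous.matrix_adjugate continuous_id).continuousOn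

theorem joinedIn_pencilSolutions_of_fst_eq {T₀ D : E →ₗ[ℂ] F} {y : F} {z : ℂ} {e e' : E}
    (h : (z, e) ∈ pencilSolutions T₀ D y) (h' : (z, e') ∈ pencilSolutions T₀ D y) :
    JoinedIn (pencilSolutions T₀ D y) (z, e) (z, e') := by
  have hc : ContinuousOn (fun t : ℝ => (z, e + (t : ℂ) • (e' - e))) (Set.Icc 0 1) := by
    fun_prop
  refine JoinedIn.ofLine hc (by simp) (by simp) ?_
  rintro _ ⟨t, -, rfl⟩
  refine ⟨h.1, ?_⟩
  have h2 := h.2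
  have h2' := h'.2
  simp only at h2 h2' ⊢
  rw [map_add, map_smul, map_sub, h2, h2', sub_self, smul_zero, add_zero]

/-- A solution over `z₀` can be moved to a solution over all but finitely many `z`. -/
theorem exists_finite_joinedIn_pencilSolutions [FiniteDimensional ℂ F] (T₀ D : E →ₗ[ℂ] F) (y : F)
    {z₀ : ℂ} {e₀ : E} (h : (z₀, e₀) ∈ pencilSolutions T₀ D y) :
    ∃ s : Set ℂ, s.Finite ∧ ∀ z ∉ s, ∃ e,
      JoinedIn (pencilSolutions T₀ D y) (z₀, e₀) (z, e) := by
  classical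
  obtain ⟨R, hR⟩ := (T₀ + z₀ • D).exists_rightInverse_of_surjective
    (LinearMap.range_eq_top.2 h.1)
  let b := Module.finBasis ℂ F
  -- `R` inverts the map at `z₀` only, but `N z` is the identity at `z₀`, so it is invertible off a
  -- finite set; there `R` composed with `(N z)⁻¹` is a right inverse continuous in `z`.
  let N : ℂ → Matrix _ _ ℂ := fun z =>
    LinearMap.toMatrix b b (T₀ ∘ₗ R) + z • LinearMap.toMatrix b b (D ∘ₗ R)
  have hN : ∀ z, N z = LinearMap.toMatrix b b ((T₀ + z • D) ∘ₗ R) := by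
    intro z
    rw [LinearMap.add_comp, LinearMap.smul_comp, map_add, map_smul]
  have hN0 : (N z₀).det ≠ 0 := by
    rw [hN, hR, LinearMap.toMatrix_id, det_one]
    exact one_ne_zero
  have hfin := finite_det_add_smul_eq_zero _ _ hN0
  set s : Set ℂ := {z : ℂ | (N z).det = 0} with hs
  let x : ℂ → F := fun z => ∑ i, ((N z)⁻¹ *ᵥ b.repr y) i • b i
  let e : ℂ → E := fun z => ∑ i, ((N z)⁻¹ *ᵥ b.repr y) i • R (b i)
  have hxe : ∀ z, R (x z) = e z := fun z => by simp [x, e, map_sum]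
  have hcont : ContinuousOn (fun z => (z, e z)) sᶜ := by
    have hinv : ContinuousOn (fun z => (N z)⁻¹) sᶜ := by
      refine continuousOn_matrix_inv.comp (Continuous.continuousOn ?_) fun z hz => hz
      fun_prop
    refine continuousOn_id.prodMk (continuousOn_finsetSum _ fun i _ => ?_)
    refine ContinuousOn.smul ?_ continuousOn_const
    have hlin : Continuous fun M : Matrix (Fin (Module.finrank ℂ F)) _ ℂ =>
        (M *ᵥ b.repr y) i := by fun_prop
    exact hlin.comp_continuousOn hinv
  have hmem : ∀ z ∈ sᶜ, (z, e z) ∈ pencilSolutions T₀ D y := by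
    intro z hz
    have hu : IsUnit (N z).det := isUnit_iff_ne_zero.2 hz
    have key : ∀ w : F, (T₀ + z • D) (R (∑ i, ((N z)⁻¹ *ᵥ b.repr w) i • b i)) = w := by
      intro w
      apply b.repr.injective
      apply DFunLike.coe_injective
      have h1 := LinearMap.toMatrix_mulVec_repr b b ((T₀ + z • D) ∘ₗ R)
        (∑ i, ((N z)⁻¹ *ᵥ b.repr w) i • b i)
      rw [LinearMap.comp_apply] at h1
      rw [← h1, ← hN, b.repr_sum_self, mulVec_mulVec, mul_nonsing_inv _ hu, one_mulVec]
    refine ⟨fun w => ⟨_, key w⟩, ?_⟩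
    simp only [← hxe]
    exact key y
  have hz₀ : z₀ ∈ sᶜ := hN0
  refine ⟨s, hfin, fun z hz => ⟨e z, ?_⟩⟩
  refine (joinedIn_pencilSolutions_of_fst_eq h (hmem z₀ hz₀)).trans ?_
  have hj := (isPathConnected_compl_of_finite hfin).joinedIn z₀ hz₀ z hz
  have := hj.map_continuousOn hcont
  exact this.mono (by rintro _ ⟨w, hw, rfl⟩; exact hmem w hw)

theorem joinedIn_pencilSolutions [FiniteDimensional ℂ F] (T₀ D : E →ₗ[ℂ] F)
    (y : F) {p p' : ℂ × E} (h : p ∈ pencilSolutions T₀ D y) (h' : p' ∈ pencilSolutions T₀ D y) :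
    JoinedIn (pencilSolutions T₀ D y) p p' := by
  obtain ⟨s, hs, H⟩ := exists_finite_joinedIn_pencilSolutions T₀ D y (z₀ := p.1) (e₀ := p.2) h
  obtain ⟨s', hs', H'⟩ :=
    exists_finite_joinedIn_pencilSolutions T₀ D y (z₀ := p'.1) (e₀ := p'.2) h'
  obtain ⟨z, hz⟩ := (hs.union hs').infinite_compl.nonempty
  obtain ⟨e, he⟩ := H z fun hzs => hz (Or.inl hzs)
  obtain ⟨e', he'⟩ := H' z fun hzs => hz (Or.inr hzs)
  exact (he.trans (joinedIn_pencilSolutions_of_fst_eq he.target_mem he'.target_mem)).trans he'.symm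

end Pencil

/-! ### Range projections -/

section RangeProj

variable {n : ℕ}

theorem isSelfAdjoint_rangeProj (x : Matrix (Fin n) (Fin n) ℂ) : (rangeProj x)ᴴ = rangeProj x := by
  have h := (isSelfAdjoint_starProjection (LinearMap.range (Matrix.toEuclideanLin x))).star_eq
  rw [← star_eq_conjTranspose]
  refine ((Matrix.toEuclideanCLM (n := Fin n) (𝕜 := ℂ)).symm.map_star' _).symm.trans ?_
  exact congrArg (Matrix.toEuclideanCLM (n := Fin n) (𝕜 := ℂ)).symm h

theorem toEuclideanCLM_rangeProj (x : Matrix (Fin n) (Fin n) ℂ) :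
    Matrix.toEuclideanCLM (n := Fin n) (𝕜 := ℂ) (rangeProj x) =
      (LinearMap.range (Matrix.toEuclideanLin x)).starProjection :=
  StarAlgEquiv.apply_symm_apply _ _

theorem rangeProj_mul_self (x : Matrix (Fin n) (Fin n) ℂ) : rangeProj x * x = x := by
  apply EquivLike.injective (Matrix.toEuclideanCLM (n := Fin n) (𝕜 := ℂ))
  rw [map_mul, toEuclideanCLM_rangeProj]
  ext1 v
  exact Submodule.starProjection_eq_self_iff.2 (LinearMap.mem_range_self (Matrix.toEuclideanLin x) v)

theorem mul_rangeProj {x : Matrix (Fin n) (Fin n) ℂ} (hx : IsIdempotentElem x) :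
    x * rangeProj x = rangeProj x := by
  apply EquivLike.injective (Matrix.toEuclideanCLM (n := Fin n) (𝕜 := ℂ))
  rw [map_mul, toEuclideanCLM_rangeProj]
  ext1 v
  obtain ⟨w, hw⟩ : (LinearMap.range (Matrix.toEuclideanLin x)).starProjection v ∈
      LinearMap.range (Matrix.toEuclideanLin x) := Submodule.starProjection_apply_mem _ _
  rw [mul_apply_eq_comp, ← hw]
  have h : Matrix.toEuclideanCLM (n := Fin n) (𝕜 := ℂ) (x * x) w =
      Matrix.toEuclideanCLM (n := Fin n) (𝕜 := ℂ) x w := by rw [hx.eq]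
  rwa [map_mul] at h

end RangeProj

/-! ### Factorizations of idempotents -/

section Factor

variable {n r : ℕ}

/-- The rows of `A` form a connected configuration: the only diagonal matrices which preserve the
column space of `A` are the scalars. -/
def OnlyScalarMultipliers (A : Matrix (Fin n) (Fin r) ℂ) : Prop :=
  ∀ (M : Matrix (Fin r) (Fin r) ℂ) (l : Fin n → ℂ), A * M = diagonal l * A → ∃ c, l = fun _ => c

/-- Consequently a subspace invariant under a diagonal matrix is invariant under its adjoint, hence
reducing. -/
theorem exists_aeval_diagonal_eq_star (l : Fin n → ℂ) :
    ∃ p : Polynomial ℂ, Polynomial.aeval (diagonal l) p = diagonal (star l) := by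
  classical
  refine ⟨Lagrange.interpolate (Finset.univ.image l) id star, ?_⟩
  have := Polynomial.aeval_algHom_apply (Matrix.diagonalAlgHom (n := Fin n) (α := ℂ) ℂ) l
    (Lagrange.interpolate (Finset.univ.image l) id star)
  rw [Matrix.diagonalAlgHom_apply] at this
  rw [this, Matrix.diagonalAlgHom_apply]
  congr 1
  ext i
  rw [Polynomial.aeval_pi_apply₂, Polynomial.coe_aeval_eq_eval]
  exact Lagrange.eval_interpolate_at_node star Function.injective_id.injOn
    (Finset.mem_image_of_mem l (Finset.mem_univ i))

theorem aeval_mul_comm_of_mul_eq {A : Matrix (Fin n) (Fin r) ℂ} {M : Matrix (Fin r) (Fin r) ℂ}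
    {D : Matrix (Fin n) (Fin n) ℂ} (h : A * M = D * A) (p : Polynomial ℂ) :
    A * Polynomial.aeval M p = Polynomial.aeval D p * A := by
  induction p using Polynomial.induction_on' with
  | add p q hp hq => rw [map_add, map_add, Matrix.mul_add, Matrix.add_mul, hp, hq]
  | monomial k a =>
    have hk : A * M ^ k = D ^ k * A := by
      induction k with
      | zero => simp
      | succ k ih => rw [pow_succ, ← Matrix.mul_assoc, ih, Matrix.mul_assoc, h, pow_succ,
          Matrix.mul_assoc]
    rw [Polynomial.aeval_monomial, Polynomial.aeval_monomial, ← Algebra.smul_def,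
      ← Algebra.smul_def, Matrix.mul_smul, Matrix.smul_mul, hk]

/-- Since `B * A = 1`, the range of `A * B` is the column space of `A`. A diagonal matrix preserving
it also has its adjoint preserving it, so it commutes with the orthogonal projection. -/
theorem relCommutant_eq_bot_iff {A : Matrix (Fin n) (Fin r) ℂ} {B : Matrix (Fin r) (Fin n) ℂ}
    (hBA : B * A = 1) : relCommutant (rangeProj (A * B)) = ⊥ ↔ OnlyScalarMultipliers A := by
  have hq : IsIdempotentElem (A * B) := by
    rw [IsIdempotentElem, Matrix.mul_assoc, ← Matrix.mul_assoc B, hBA, Matrix.one_mul]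
  have hP := isSelfAdjoint_rangeProj (A * B)
  have hPq := rangeProj_mul_self (A * B)
  have hqP := mul_rangeProj hq
  set P := rangeProj (A * B)
  have hPA : P * A = A := by
    have := congrArg (· * A) hPq
    simpa only [Matrix.mul_assoc, hBA, Matrix.mul_one] using this
  constructor
  · intro h M l hM
    obtain ⟨p, hp⟩ := exists_aeval_diagonal_eq_star l
    have inv : ∀ (D : Matrix (Fin n) (Fin n) ℂ) (M : Matrix (Fin r) (Fin r) ℂ),
        A * M = D * A → P * (D * P) = D * P := by
      intro D M hM
      have : D * P = A * (M * (B * P)) := by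
        conv_lhs => rw [← hqP]
        rw [Matrix.mul_assoc A B, ← Matrix.mul_assoc D, ← hM, Matrix.mul_assoc]
      rw [this, ← Matrix.mul_assoc, hPA]
    have h1 := inv _ _ hM
    have h2 := inv _ _ (aeval_mul_comm_of_mul_eq hM p)
    rw [hp] at h2
    have h3 := congrArg conjTranspose h2
    simp only [conjTranspose_mul, diagonal_conjTranspose, star_star, hP] at h3
    have hmem : diagonal l ∈ relCommutant P := by
      refine ⟨?_, ⟨l, rfl⟩⟩
      change diagonal l ∈ Subalgebra.centralizer ℂ {P}
      rw [Subalgebra.mem_centralizer_iff]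
      rintro _ rfl
      rw [← h3, Matrix.mul_assoc, h1]
    rw [h, Algebra.mem_bot] at hmem
    obtain ⟨c, hc⟩ := hmem
    refine ⟨c, ?_⟩
    rw [Matrix.algebraMap_eq_diagonal] at hc
    exact (diagonal_injective hc).symm
  · intro h
    rw [eq_bot_iff]
    rintro D ⟨hD, ⟨l, rfl⟩⟩
    change diagonal l ∈ Subalgebra.centralizer ℂ {P} at hD
    rw [Subalgebra.mem_centralizer_iff] at hD
    have hc := hD P rfl
    obtain ⟨c, rfl⟩ := h (B * (P * (diagonal l * A))) l (by
      rw [← Matrix.mul_assoc, ← Matrix.mul_assoc, hqP, ← Matrix.mul_assoc, hc, Matrix.mul_assoc,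
        hPA])
    rw [Algebra.mem_bot]
    exact ⟨c, by rw [Matrix.algebraMap_eq_diagonal]; rfl⟩

/-- The map `(B, c) ↦ (B A, diag (A B) + c 1)`. -/
def factorMap (A : Matrix (Fin n) (Fin r) ℂ) :
    (Matrix (Fin r) (Fin n) ℂ × ℂ) →ₗ[ℂ] (Matrix (Fin r) (Fin r) ℂ × (Fin n → ℂ)) where
  toFun e := (e.1 * A, (A * e.1).diag + fun _ => e.2)
  map_add' e f := by
    ext
    · simp [Matrix.add_mul]
    · simp [Matrix.mul_add]; ring
  map_smul' c e := by
    ext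
    · simp
    · simp

theorem factorMap_apply (A : Matrix (Fin n) (Fin r) ℂ) (e : Matrix (Fin r) (Fin n) ℂ × ℂ) :
    factorMap A e = (e.1 * A, (A * e.1).diag + fun _ => e.2) := rfl

theorem factorMap_add_smul (A A' : Matrix (Fin n) (Fin r) ℂ) (z : ℂ) :
    factorMap A + z • (factorMap A' - factorMap A) = factorMap (A + z • (A' - A)) := by
  refine LinearMap.ext fun e => ?_
  simp only [LinearMap.add_apply, LinearMap.smul_apply, LinearMap.sub_apply, factorMap_apply]
  ext i
  · simp [Matrix.mul_add, Matrix.mul_sub]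
  · simp [Matrix.add_mul, Matrix.sub_mul]; ring

theorem trace_mul_mul_eq_iff (A : Matrix (Fin n) (Fin r) ℂ) (M : Matrix (Fin r) (Fin r) ℂ)
    (l : Fin n → ℂ) :
    A * M = diagonal l * A ↔
      ∀ B : Matrix (Fin r) (Fin n) ℂ, (B * A * M).trace = ∑ i, l i * (A * B).diag i := by
  have key : ∀ B : Matrix (Fin r) (Fin n) ℂ,
      ∑ i, l i * (A * B).diag i = (B * (diagonal l * A)).trace := by
    intro B
    rw [Matrix.trace_mul_comm, Matrix.mul_assoc, Matrix.trace]
    simp [Matrix.diagonal_mul]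
  simp_rw [key, Matrix.mul_assoc]
  rw [Matrix.ext_iff_trace_mul_left]

/-- A functional vanishing on the range has the form `tr (N * M) - ∑ l i * t i` with `A * M =
diagonal l * A`. Irreducibility makes `l` and `M` the same scalar `c`, and the slack coordinate
forces `n * c = 0`. -/
theorem surjective_factorMap [NeZero n] {A : Matrix (Fin n) (Fin r) ℂ}
    {B : Matrix (Fin r) (Fin n) ℂ} (hBA : B * A = 1) (hA : OnlyScalarMultipliers A) :
    Function.Surjective (factorMap A) := by
  rw [← LinearMap.dualMap_injective_iff, injective_iff_map_eq_zero]
  intro f hf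
  have hf : ∀ e, f (factorMap A e) = 0 := fun e => LinearMap.congr_fun hf e
  let M : Matrix (Fin r) (Fin r) ℂ := Matrix.of fun j i => f (Matrix.single i j 1, 0)
  let l : Fin n → ℂ := fun i => - f (0, Pi.single i 1)
  have hrep : ∀ (N : Matrix (Fin r) (Fin r) ℂ) (t : Fin n → ℂ), f (N, t) = (N * M).trace - ∑ i, l i * t i := by
    intro N t
    have h1 : f (N, 0) = (N * M).trace := by
      conv_lhs => rw [Matrix.matrix_eq_sum_single N]
      have : ((∑ i, ∑ j, Matrix.single i j (N i j), 0) :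
          Matrix (Fin r) (Fin r) ℂ × (Fin n → ℂ)) =
          ∑ i, ∑ j, N i j • (Matrix.single i j (1 : ℂ), (0 : Fin n → ℂ)) := by
        ext <;> simp [Prod.fst_sum, Prod.snd_sum]
      rw [this]
      simp only [map_sum, map_smul, Matrix.trace, Matrix.diag, Matrix.mul_apply, M, Matrix.of_apply,
        smul_eq_mul]
    have h2 : f (0, t) = - ∑ i, l i * t i := by
      have : ((0, t) : Matrix (Fin r) (Fin r) ℂ × (Fin n → ℂ)) =
          ∑ i, t i • ((0 : Matrix (Fin r) (Fin r) ℂ), (Pi.single i 1 : Fin n → ℂ)) := by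
        ext <;> simp [Prod.fst_sum, Prod.snd_sum, Pi.single_apply]
      rw [this]
      simp only [map_sum, map_smul, l, smul_eq_mul, ← Finset.sum_neg_distrib]
      exact Finset.sum_congr rfl fun i _ => by ring
    have : ((N, t) : Matrix (Fin r) (Fin r) ℂ × (Fin n → ℂ)) = (N, 0) + (0, t) := by simp
    rw [this, map_add, h1, h2, sub_eq_add_neg]
  have hM : A * M = diagonal l * A := by
    rw [trace_mul_mul_eq_iff]
    intro C
    have := hf (C, 0)
    rw [factorMap_apply, hrep] at this
    simpa [sub_eq_zero] using this
  obtain ⟨c, hl⟩ := hA M l hM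
  have hMc : M = diagonal fun _ => c := by
    have := congrArg (B * ·) hM
    simp only [← Matrix.mul_assoc, hBA, Matrix.one_mul, hl] at this
    rw [this, ← Matrix.smul_one_eq_diagonal, ← Matrix.smul_one_eq_diagonal, Matrix.mul_smul,
      Matrix.smul_mul, Matrix.mul_one, hBA]
  have hc : c = 0 := by
    have := hf (0, 1)
    rw [factorMap_apply, hrep, hl] at this
    simpa [NeZero.ne n] using this
  refine LinearMap.ext fun ⟨N, t⟩ => ?_
  rw [hrep, hMc, hl, hc]
  simp

theorem onlyScalarMultipliers_of_surjective_factorMap {A : Matrix (Fin n) (Fin r) ℂ}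
    (hA : Function.Surjective (factorMap A)) : OnlyScalarMultipliers A := by
  intro M l hM
  rw [trace_mul_mul_eq_iff] at hM
  -- The functional of `(M, l)` kills every `(B * A, diag (A * B))`, so it sees only the slack `c`,
  -- which is read off from `tr N - ∑ t i = -n * c`.
  have key : ∀ (N : Matrix (Fin r) (Fin r) ℂ) (t : Fin n → ℂ), (n : ℂ) * ((N * M).trace - ∑ i, l i * t i) =
      (∑ i, l i) * (N.trace - ∑ i, t i) := by
    intro N t
    obtain ⟨⟨B, c⟩, h⟩ := hA (N, t)
    rw [factorMap_apply, Prod.mk.injEq] at h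
    obtain ⟨rfl, rfl⟩ := h
    have htr : ∑ i, (A * B) i i = (A * B).trace := rfl
    simp only [hM, Pi.add_apply, mul_add, Finset.sum_add_distrib, ← Finset.sum_mul, Matrix.diag,
      htr, Matrix.trace_mul_comm B A]
    simp
    ring
  refine ⟨(∑ i, l i) / n, funext fun i => ?_⟩
  have hn : (n : ℂ) ≠ 0 := Nat.cast_ne_zero.2 (Fin.pos i).ne'
  have := key 0 (Pi.single i 1)
  simp [Pi.single_apply] at this
  field_simp
  linear_combination this

theorem mul_mem_irreducibleIdempotents [NeZero n] {A : Matrix (Fin n) (Fin r) ℂ}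
    {t : Fin n → ℂ} (ht : ∑ i, t i = r) (hA : Function.Surjective (factorMap A))
    {e : Matrix (Fin r) (Fin n) ℂ × ℂ} (he : factorMap A e = (1, t)) :
    A * e.1 ∈ irreducibleIdempotents (diagonal t) := by
  rw [factorMap_apply, Prod.mk.injEq] at he
  obtain ⟨hBA, hd⟩ := he
  -- Both traces equal `r`, so the slack vanishes.
  have hc : e.2 = 0 := by
    have h1 : ∑ i, ((A * e.1).diag + fun _ => e.2 : Fin n → ℂ) i = r := by rw [hd, ht]
    have htr : ∑ i, (A * e.1).diag i = r := by
      change (A * e.1).trace = r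
      rw [Matrix.trace_mul_comm, hBA]
      simp
    simp only [Pi.add_apply, Finset.sum_add_distrib, htr] at h1
    simpa [NeZero.ne n] using h1
  refine ⟨?_, ?_, ?_⟩
  · rw [IsIdempotentElem, Matrix.mul_assoc, ← Matrix.mul_assoc e.1, hBA, Matrix.one_mul]
  · rw [condExpDiag, ← hd, hc]
    congr 1
    ext i
    simp
  · exact (relCommutant_eq_bot_iff hBA).2 (onlyScalarMultipliers_of_surjective_factorMap hA)

theorem exists_factorization {q : Matrix (Fin n) (Fin n) ℂ} (hq : IsIdempotentElem q) :
    ∃ (r : ℕ) (A : Matrix (Fin n) (Fin r) ℂ) (B : Matrix (Fin r) (Fin n) ℂ),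
      B * A = 1 ∧ A * B = q := by
  let f := Matrix.toLin' q
  have hf : ∀ v, f (f v) = f v := fun v => by
    simp only [f, Matrix.toLin'_apply, Matrix.mulVec_mulVec, hq.eq]
  let φ := (Module.finBasis ℂ (LinearMap.range f)).equivFun
  let g : (Fin n → ℂ) →ₗ[ℂ] _ := φ.toLinearMap ∘ₗ f.rangeRestrict
  let h := (LinearMap.range f).subtype ∘ₗ φ.symm.toLinearMap
  refine ⟨_, LinearMap.toMatrix' h, LinearMap.toMatrix' g, ?_, ?_⟩
  · rw [← LinearMap.toMatrix'_comp, ← LinearMap.toMatrix'_id]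
    congr 1
    refine LinearMap.ext fun v => ?_
    have : f.rangeRestrict (φ.symm v : Fin n → ℂ) = φ.symm v := by
      obtain ⟨w, hw⟩ := (φ.symm v).2
      apply Subtype.ext
      rw [LinearMap.codRestrict_apply, ← hw, hf]
    simp only [g, h, LinearMap.comp_apply, Submodule.subtype_apply, LinearEquiv.coe_coe, this,
      LinearEquiv.apply_symm_apply, LinearMap.id_apply]
  · rw [← LinearMap.toMatrix'_comp]
    have : h ∘ₗ g = f := by
      refine LinearMap.ext fun v => ?_
      simp [g, h]
    rw [this, LinearMap.toMatrix'_toLin']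

theorem joinedIn_irreducibleIdempotents [NeZero n] {d q q' : Matrix (Fin n) (Fin n) ℂ}
    (h : q ∈ irreducibleIdempotents d) (h' : q' ∈ irreducibleIdempotents d) :
    JoinedIn (irreducibleIdempotents d) q q' := by
  obtain ⟨r, A, B, hBA, rfl⟩ := exists_factorization h.1
  obtain ⟨r', A', B', hBA', rfl⟩ := exists_factorization h'.1
  set t : Fin n → ℂ := (A * B).diag with ht
  have hdt : d = diagonal t := h.2.1.symm
  subst hdt
  have ht' : (A' * B').diag = t := diagonal_injective h'.2.1
  have htr : ∑ i, t i = r := by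
    change (A * B).trace = r
    rw [Matrix.trace_mul_comm, hBA]
    simp
  have htr' : ∑ i, t i = r' := by
    rw [← ht']
    change (A' * B').trace = r'
    rw [Matrix.trace_mul_comm, hBA']
    simp
  -- Both ranks are the trace of `d`, so `A` and `A'` have the same shape and span a line.
  obtain rfl : r = r' := by exact_mod_cast htr.symm.trans htr'
  have hs := surjective_factorMap hBA ((relCommutant_eq_bot_iff hBA).1 h.2.2)
  have hs' := surjective_factorMap hBA' ((relCommutant_eq_bot_iff hBA').1 h'.2.2)
  have hp : ((0 : ℂ), (B, (0 : ℂ))) ∈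
      pencilSolutions (factorMap A) (factorMap A' - factorMap A) (1, t) := by
    refine ⟨by simpa using hs, ?_⟩
    simp only [zero_smul, add_zero, factorMap_apply, hBA, ← ht]
    congr 1
    ext i
    simp
  have hp' : ((1 : ℂ), (B', (0 : ℂ))) ∈
      pencilSolutions (factorMap A) (factorMap A' - factorMap A) (1, t) := by
    refine ⟨by simpa using hs', ?_⟩
    simp only [one_smul, add_sub_cancel, factorMap_apply, hBA', ht']
    congr 1
    ext i
    simp
  have hc : Continuous fun p : ℂ × (Matrix (Fin r) (Fin n) ℂ × ℂ) =>
      (A + p.1 • (A' - A)) * p.2.1 := by fun_prop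
  have := (joinedIn_pencilSolutions _ _ _ hp hp').map_continuousOn hc.continuousOn
  simp only [zero_smul, add_zero, one_smul, add_sub_cancel] at this
  refine this.mono ?_
  rintro _ ⟨p, ⟨h1, h2⟩, rfl⟩
  rw [factorMap_add_smul] at h1 h2
  exact mul_mem_irreducibleIdempotents htr h1 h2

end Factor

end FixedDiagonal

theorem mainTheorem7 (n : ℕ) (d : Matrix (Fin n) (Fin n) ℂ) (hd : d ∈ FixedDiagonal.diagAlg n)
    (hne : (FixedDiagonal.irreducibleIdempotents d).Nonempty) :
    IsPathConnected (FixedDiagonal.irreducibleIdempotents d) := by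
  obtain ⟨q, hq⟩ := hne
  refine ⟨q, hq, fun {q'} hq' => ?_⟩
  -- Cancelling `n * c = 0` needs `n ≠ 0`; for `n = 0` there is only one matrix.
  rcases Nat.eq_zero_or_pos n with rfl | hn
  · obtain rfl : q = q' := Subsingleton.elim _ _
    exact JoinedIn.refl hq
  · have : NeZero n := ⟨hn.ne'⟩
    exact FixedDiagonal.joinedIn_irreducibleIdempotents hq hq'
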